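/- Let $D\ge 2$ be an integer, let $X$ be the power set of a $D$-element set, and let $H(D,2)$ be the hypercube graph on $X$, in which $x,y\in X$ are adjacent if and only if one covers the other in $(X,\subseteq)$. Let $R_i$ be its $i$-th distance relation. Define linear operators on the complex vector space $\mathbb C^X$ with basis $X$ by $$\mathbf A_2^J x=\sum_{|y|=|x|,\ (x,y)\in R_2} y,\qquad \mathbf A_2^{\bar J} x=\sum_{|y|\ne|x|,\ (x,y)\in R_2} y,\qquad \mathbf A_2^{*} x=\frac{(D-2|x|)^2-D}{2}\,x\qquad(x\in X),$$ and let $\mathbf R$ be the subalgebra of $\mathrm{End}(\mathbb C^X)$ generated by $\mathbf A_2^J,\mathbf A_2^{\bar J},\mathbf A_2^*$. Let $X_e=\{x\in X: |x|\text{ is even}\}$. The subspace $\mathbb C^{X_e}$ is invariant under $\mathbf R$; put $\mathbf R_e=\{M|_{\mathbb C^{X_e}} : M\in\mathbf R\}\subseteq \mathrm{End}(\mathbb C^{X_e})$. Let $U(\mathfrak{sl}_2)$ be the complex unital associative algebra with generators $E,F,H$ and relations $[H,E]=2E$, $[H,F]=-2F$, $[E,F]=H$. For $n\in\mathbb Z$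 let $U_n$ be the span of all $E^iF^jH^k$ with $i,j,k\in\mathbb N$ and $i-j=n$, and let $U(\mathfrak{sl}_2)_e=\bigoplus_{n\in\mathbb Z}U_{2n}$, a subalgebra of $U(\mathfrak{sl}_2)$. The algebra $U(\mathfrak{sl}_2)$ acts on $\mathbb C^X$ by $$Ex=\sum_{|y|<|x|,\ (x,y)\in R_1}y,\qquad Fx=\sum_{|y|>|x|,\ (x,y)\in R_1}y,\qquad Hx=(D-2|x|)x\qquad(x\in X),$$ and $U(\mathfrak{sl}_2)_e$ leaves $\mathbb C^{X_e}$ invariant. Let $\mathbf T_e$ be the image of $U(\mathfrak{sl}_2)_e$ in $\mathrm{End}(\mathbb C^{X_e})$. Then: 1. $\mathbf T_e$ is the Terwilliger algebra with respect to $\emptyset$ of the halved cube $\frac12H(D,2)$ (the graph on $X_e$ in which $x,y$ are adjacent if and only if $(x,y)\in R_2$), that is, the subalgebra of $\mathrm{End}(\mathbb C^{X_e})$ generated by the adjacency operator and the projections $E_i^*$ of $\mathbb C^{X_e}$ onto the span of the vertices at distance $i$ from $\emptyset$ in $\frac12H(D,2)$. 2. $\mathbf R_e$ is a subalgebra of $\mathbf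 T_e$. 3. $\mathbf R_e=\mathbf T_e$ if and only if $D$ is odd. -/

import Mathlib

/-! ## The algebra `U(sl₂)` and its even subalgebra -/

namespace SlTwo

inductive Gen
  | E
  | F
  | H

/-- The defining relations `[H,E] = 2E`, `[H,F] = -2F`, `[E,F] = H`. -/
inductive Rel : FreeAlgebra ℂ Gen → FreeAlgebra ℂ Gen → Prop
  | HE : Rel (FreeAlgebra.ι ℂ Gen.H * FreeAlgebra.ι ℂ Gen.E
        - FreeAlgebra.ι ℂ Gen.E * FreeAlgebra.ι ℂ Gen.H) ((2 : ℂ) • FreeAlgebra.ι ℂ Gen.E)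
  | HF : Rel (FreeAlgebra.ι ℂ Gen.H * FreeAlgebra.ι ℂ Gen.F
        - FreeAlgebra.ι ℂ Gen.F * FreeAlgebra.ι ℂ Gen.H) ((-2 : ℂ) • FreeAlgebra.ι ℂ Gen.F)
  | EF : Rel (FreeAlgebra.ι ℂ Gen.E * FreeAlgebra.ι ℂ Gen.F
        - FreeAlgebra.ι ℂ Gen.F * FreeAlgebra.ι ℂ Gen.E) (FreeAlgebra.ι ℂ Gen.H)

/-- The universal enveloping algebra `U(sl₂)` over `ℂ`, by generators and relations. -/
abbrev U : Type := RingQuot Rel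

noncomputable def E : U := RingQuot.mkAlgHom ℂ Rel (FreeAlgebra.ι ℂ Gen.E)
noncomputable def F : U := RingQuot.mkAlgHom ℂ Rel (FreeAlgebra.ι ℂ Gen.F)
noncomputable def H : U := RingQuot.mkAlgHom ℂ Rel (FreeAlgebra.ι ℂ Gen.H)

theorem rel_HE : H * E - E * H = (2 : ℂ) • E := by
  have := RingQuot.mkAlgHom_rel ℂ Rel.HE
  simpa [E, F, H] using this

theorem rel_HF : H * F - F * H = (-2 : ℂ) • F := by
  have := RingQuot.mkAlgHom_rel ℂ Rel.HF
  simpa only [F, H, map_sub, map_mul, map_smul] using this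

theorem rel_EF : E * F - F * E = H := by
  have := RingQuot.mkAlgHom_rel ℂ Rel.EF
  simpa [E, F, H] using this

/-- The homomorphism out of `U(sl₂)` determined by a triple satisfying the relations. -/
noncomputable def lift {A : Type*} [Ring A] [Algebra ℂ A] (e f h : A)
    (he : h * e - e * h = (2 : ℂ) • e) (hf : h * f - f * h = (-2 : ℂ) • f)
    (hh : e * f - f * e = h) : U →ₐ[ℂ] A :=
  RingQuot.liftAlgHom ℂ ⟨FreeAlgebra.lift ℂ (fun g : Gen => match g with
    | Gen.E => e
    | Gen.F => f
    | Gen.H => h), by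
      intro x y hxy
      cases hxy <;> simp [he, hf, hh]⟩

section

variable {A : Type*} [Ring A] [Algebra ℂ A] (e f h : A)
    (he : h * e - e * h = (2 : ℂ) • e) (hf : h * f - f * h = (-2 : ℂ) • f)
    (hh : e * f - f * e = h)

@[simp] theorem lift_E : lift e f h he hf hh E = e := by
  simp [lift, E, RingQuot.liftAlgHom_mkAlgHom_apply]

@[simp] theorem lift_F : lift e f h he hf hh F = f := by
  simp [lift, F, RingQuot.liftAlgHom_mkAlgHom_apply]

@[simp] theorem lift_H : lift e f h he hf hh H = h := by
  simp [lift, H, RingQuot.liftAlgHom_mkAlgHom_apply]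

end

/-- The homogeneous subspace `U_n`, spanned by the `E^i F^j H^k` with `i - j = n`. -/
noncomputable def homogeneous (n : ℤ) : Submodule ℂ U :=
  Submodule.span ℂ {u | ∃ i j k : ℕ, (i : ℤ) - (j : ℤ) = n ∧ u = E ^ i * F ^ j * H ^ k}

theorem algebraMap_two : algebraMap ℂ U 2 = 2 := map_ofNat _ 2

theorem mon_aeval_mem (i j : ℕ) (n : ℤ) (hn : (i : ℤ) - (j : ℤ) = n) (p : Polynomial ℂ) :
    E ^ i * F ^ j * Polynomial.aeval H p ∈ homogeneous n := by
  induction p using Polynomial.induction_on' with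
  | add p q hp hq => rw [map_add, mul_add]; exact add_mem hp hq
  | monomial k a =>
    rw [Polynomial.aeval_monomial, ← Algebra.smul_def, mul_smul_comm]
    exact Submodule.smul_mem _ _ (Submodule.subset_span ⟨i, j, k, hn, rfl⟩)

theorem H_pow_mul_E (k : ℕ) : H ^ k * E = E * (H + 2) ^ k := by
  have h : SemiconjBy E (H + 2) H := by
    have := rel_HE
    rw [sub_eq_iff_eq_add] at this
    rw [SemiconjBy, this, mul_add, mul_two, two_smul, add_comm]
  exact ((h.pow_right k).eq).symm

theorem H_pow_mul_F (k : ℕ) : H ^ k * F = F * (H - 2) ^ k := by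
  have h : SemiconjBy F (H - 2) H := by
    have := rel_HF
    rw [sub_eq_iff_eq_add] at this
    rw [SemiconjBy, this, mul_sub, mul_two]
    module
  exact ((h.pow_right k).eq).symm

theorem H_mul_F_pow (j : ℕ) : H * F ^ j = F ^ j * H - (2 * j : ℂ) • F ^ j := by
  induction j with
  | zero => simp
  | succ j ih =>
    have h : H * F = F * H + (-2 : ℂ) • F := by rw [← rel_HF]; abel
    rw [pow_succ, ← mul_assoc, ih, sub_mul, mul_assoc, h, mul_add, ← mul_assoc, mul_smul_comm,
      smul_mul_assoc]
    push_cast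
    module

theorem F_pow_succ_mul_E (j : ℕ) :
    F ^ (j + 1) * E = E * F ^ (j + 1) - (j + 1 : ℂ) • (F ^ j * H)
      + ((j + 1) * j : ℂ) • F ^ j := by
  have h1 : F * E = E * F - H := by rw [← rel_EF]; abel
  induction j with
  | zero => simp [h1]
  | succ j ih =>
    calc F ^ (j + 1 + 1) * E = F * (F ^ (j + 1) * E) := by rw [pow_succ', mul_assoc]
      _ = F * E * F ^ (j + 1) - (j + 1 : ℂ) • (F ^ (j + 1) * H)
          + ((j + 1) * j : ℂ) • F ^ (j + 1) := by
          rw [ih, mul_add, mul_sub, mul_smul_comm, mul_smul_comm, ← mul_assoc, ← mul_assoc,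
            ← pow_succ']
      _ = E * F ^ (j + 1 + 1) - H * F ^ (j + 1) - (j + 1 : ℂ) • (F ^ (j + 1) * H)
          + ((j + 1) * j : ℂ) • F ^ (j + 1) := by
          rw [h1, sub_mul, mul_assoc, ← pow_succ']
      _ = _ := by
          rw [H_mul_F_pow]
          push_cast
          module

theorem homogeneous_mul_H {n : ℤ} {u : U} (hu : u ∈ homogeneous n) : u * H ∈ homogeneous n := by
  induction hu using Submodule.span_induction with
  | mem x hx =>
    obtain ⟨i, j, k, hn, rfl⟩ := hx
    exact Submodule.subset_span ⟨i, j, k + 1, hn, by rw [pow_succ, mul_assoc]⟩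
  | zero => simp
  | add x y _ _ hx hy => rw [add_mul]; exact add_mem hx hy
  | smul a x _ hx => rw [smul_mul_assoc]; exact Submodule.smul_mem _ _ hx

theorem homogeneous_mul_F {n : ℤ} {u : U} (hu : u ∈ homogeneous n) :
    u * F ∈ homogeneous (n - 1) := by
  induction hu using Submodule.span_induction with
  | mem x hx =>
    obtain ⟨i, j, k, hn, rfl⟩ := hx
    have := mon_aeval_mem i (j + 1) (n - 1) (by push_cast; omega)
      ((Polynomial.X - Polynomial.C 2) ^ k)
    rw [mul_assoc, H_pow_mul_F]
    simpa [pow_succ, mul_assoc, algebraMap_two] using this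
  | zero => simp
  | add x y _ _ hx hy => rw [add_mul]; exact add_mem hx hy
  | smul a x _ hx => rw [smul_mul_assoc]; exact Submodule.smul_mem _ _ hx

theorem homogeneous_mul_E {n : ℤ} {u : U} (hu : u ∈ homogeneous n) :
    u * E ∈ homogeneous (n + 1) := by
  induction hu using Submodule.span_induction with
  | mem x hx =>
    obtain ⟨i, j, k, hn, rfl⟩ := hx
    rw [mul_assoc, H_pow_mul_E]
    cases j with
    | zero =>
      have := mon_aeval_mem (i + 1) 0 (n + 1) (by push_cast at hn ⊢; omega)
        ((Polynomial.X + Polynomial.C 2) ^ k)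
      simpa [pow_succ, mul_assoc, algebraMap_two] using this
    | succ j =>
      have h1 := mon_aeval_mem (i + 1) (j + 1) (n + 1) (by push_cast at hn ⊢; omega)
        ((Polynomial.X + Polynomial.C 2) ^ k)
      have h2 := mon_aeval_mem i j (n + 1) (by push_cast at hn ⊢; omega)
        (Polynomial.X * (Polynomial.X + Polynomial.C 2) ^ k)
      have h3 := mon_aeval_mem i j (n + 1) (by push_cast at hn ⊢; omega)
        ((Polynomial.X + Polynomial.C 2) ^ k)
      have h4 : E ^ i * F ^ (j + 1) * (E * (H + 2) ^ k)
          = E ^ (i + 1) * F ^ (j + 1) * (H + 2) ^ k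
            - (j + 1 : ℂ) • (E ^ i * F ^ j * (H * (H + 2) ^ k))
            + ((j + 1) * j : ℂ) • (E ^ i * F ^ j * (H + 2) ^ k) := by
        calc E ^ i * F ^ (j + 1) * (E * (H + 2) ^ k)
            = E ^ i * (F ^ (j + 1) * E) * (H + 2) ^ k := by simp only [mul_assoc]
          _ = _ := by
            rw [F_pow_succ_mul_E, mul_add, mul_sub, add_mul, sub_mul, pow_succ E i]
            simp only [mul_assoc, mul_smul_comm, smul_mul_assoc]
      rw [h4]
      refine add_mem (sub_mem ?_ (Submodule.smul_mem _ _ ?_)) (Submodule.smul_mem _ _ ?_)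
      · simpa [algebraMap_two] using h1
      · simpa [algebraMap_two] using h2
      · simpa [algebraMap_two] using h3
  | zero => simp
  | add x y _ _ hx hy => rw [add_mul]; exact add_mem hx hy
  | smul a x _ hx => rw [smul_mul_assoc]; exact Submodule.smul_mem _ _ hx

theorem homogeneous_mul {m n : ℤ} {u v : U} (hu : u ∈ homogeneous m) (hv : v ∈ homogeneous n) :
    u * v ∈ homogeneous (m + n) := by
  induction hv using Submodule.span_induction with
  | mem x hx =>
    obtain ⟨i, j, k, hn, rfl⟩ := hx
    have h1 : ∀ i : ℕ, u * E ^ i ∈ homogeneous (m + i) := by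
      intro i
      induction i with
      | zero => simpa using hu
      | succ i ih =>
        rw [pow_succ, ← mul_assoc]
        have := homogeneous_mul_E ih
        push_cast
        rwa [← add_assoc]
    have h2 : ∀ j : ℕ, u * E ^ i * F ^ j ∈ homogeneous (m + i - j) := by
      intro j
      induction j with
      | zero => simpa using h1 i
      | succ j ih =>
        rw [pow_succ, ← mul_assoc]
        have := homogeneous_mul_F ih
        push_cast
        rwa [← sub_sub]
    have h3 : ∀ k : ℕ, u * E ^ i * F ^ j * H ^ k ∈ homogeneous (m + i - j) := by
      intro k
      induction k with
      | zero => simpa using h2 j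
      | succ k ih =>
        rw [pow_succ, ← mul_assoc]
        exact homogeneous_mul_H ih
    have h4 : m + n = m + i - j := by omega
    rw [h4]
    simpa only [mul_assoc] using h3 k
  | zero => simp
  | add x y _ _ hx hy => rw [mul_add]; exact add_mem hx hy
  | smul a x _ hx => rw [mul_smul_comm]; exact Submodule.smul_mem _ _ hx

theorem one_mem_homogeneous : (1 : U) ∈ homogeneous 0 :=
  Submodule.subset_span ⟨0, 0, 0, by simp, by simp⟩

/-- The even subalgebra `U(sl₂)_e`, the (direct) sum of all `U_{2n}`, `n ∈ ℤ`. -/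
noncomputable def Ue : Subalgebra ℂ U :=
  (⨆ n : ℤ, homogeneous (2 * n)).toSubalgebra
    (Submodule.mem_iSup_of_mem 0 (by simpa using one_mem_homogeneous))
    (by
      intro x y hx hy
      induction hx using Submodule.iSup_induction' with
      | zero => simp
      | add a b _ _ ha hb => rw [add_mul]; exact add_mem ha hb
      | mem m x hx =>
        induction hy using Submodule.iSup_induction' with
        | zero => simp
        | add a b _ _ ha hb => rw [mul_add]; exact add_mem ha hb
        | mem n y hy =>
          refine Submodule.mem_iSup_of_mem (m + n) ?_
          rw [mul_add]
          exact homogeneous_mul hx hy)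

theorem mem_Ue {u : U} : u ∈ Ue ↔ u ∈ ⨆ n : ℤ, homogeneous (2 * n) := Iff.rfl

end SlTwo

/-! ## Terwilliger algebras of graphs and restriction of operators -/

/-- The operator on `ℂ^X` sending each `x ∈ X` to `c x`. -/
noncomputable def opOfBasis {X : Type*} (c : X → (X →₀ ℂ)) : Module.End ℂ (X →₀ ℂ) :=
  Finsupp.linearCombination ℂ c

@[simp] theorem opOfBasis_single {X : Type*} (c : X → (X →₀ ℂ)) (x : X) :
    opOfBasis c (Finsupp.single x 1) = c x := by
  simp [opOfBasis]

open Classical in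
/-- The adjacency operator of a finite graph. -/
noncomputable def adjacencyOp {X : Type*} [Fintype X] (G : SimpleGraph X) :
    Module.End ℂ (X →₀ ℂ) :=
  opOfBasis fun x => ∑ y with G.Adj x y, Finsupp.single y 1

/-- The `i`-th dual idempotent `E_i^*` of a graph with respect to the base vertex `x₀`: the
projection of `ℂ^X` onto the span of the vertices at distance `i` from `x₀`. -/
noncomputable def dualIdempotent {X : Type*} (G : SimpleGraph X) (x₀ : X) (i : ℕ) :
    Module.End ℂ (X →₀ ℂ) :=
  opOfBasis fun x => if G.dist x₀ x = i then Finsupp.single x 1 else 0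

/-- The Terwilliger algebra of a finite connected (distance-regular) graph with respect to the
base vertex `x₀`, generated by the adjacency operator and the dual idempotents. -/
noncomputable def terwilligerAlgebra {X : Type*} [Fintype X] (G : SimpleGraph X) (x₀ : X) :
    Subalgebra ℂ (Module.End ℂ (X →₀ ℂ)) :=
  Algebra.adjoin ℂ ({adjacencyOp G} ∪ Set.range (dualIdempotent G x₀))

section Restriction

variable {V : Type*} [AddCommGroup V] [Module ℂ V]

/-- The operators that leave the subspace `W` invariant. -/
def invariantSubalgebra (W : Submodule ℂ V) : Subalgebra ℂ (Module.End ℂ V) where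
  carrier := {f | ∀ v ∈ W, f v ∈ W}
  mul_mem' := fun hf hg v hv => hf _ (hg v hv)
  add_mem' := fun hf hg v hv => W.add_mem (hf v hv) (hg v hv)
  algebraMap_mem' := fun r v hv => by
    simpa [Module.algebraMap_end_apply] using W.smul_mem r hv

/-- Restriction of operators to an invariant subspace, as an algebra homomorphism. -/
def restrictHom (W : Submodule ℂ V) : invariantSubalgebra W →ₐ[ℂ] Module.End ℂ W where
  toFun f := LinearMap.restrict f.1 f.2
  map_one' := rfl
  map_mul' _ _ := rfl
  map_zero' := rfl
  map_add' _ _ := rfl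
  commutes' _ := rfl

end Restriction

/-! ## The hypercube and the halved cube -/

namespace Hypercube

open Finset

/-- The vertex set of `H(D,2)`: the power set of a `D`-element set. -/
abbrev X (D : ℕ) : Type := Finset (Fin D)

/-- The hypercube `H(D,2)`: adjacency is the covering relation of `(X, ⊆)`. -/
def graph (D : ℕ) : SimpleGraph (X D) where
  Adj x y := x ⋖ y ∨ y ⋖ x
  symm := ⟨fun _ _ h => h.symm⟩
  loopless := ⟨fun x h => by
    rcases h with h | h <;> exact lt_irrefl x h.lt⟩

/-- The `i`-th distance relation `R_i` of `H(D,2)`. -/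
abbrev R {D : ℕ} (i : ℕ) (x y : X D) : Prop := (graph D).dist x y = i

/-- The actions of `E`, `F`, `H` on `ℂ^X`. -/
noncomputable def opE (D : ℕ) : Module.End ℂ (X D →₀ ℂ) :=
  opOfBasis fun x => ∑ y with y.card < x.card ∧ R 1 x y, Finsupp.single y 1

noncomputable def opF (D : ℕ) : Module.End ℂ (X D →₀ ℂ) :=
  opOfBasis fun x => ∑ y with x.card < y.card ∧ R 1 x y, Finsupp.single y 1

noncomputable def opH (D : ℕ) : Module.End ℂ (X D →₀ ℂ) :=
  opOfBasis fun x => ((D : ℂ) - 2 * (x.card : ℂ)) • Finsupp.single x 1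

/-- The part `A₂^J` of the second distance operator inside the levels (Johnson graphs). -/
noncomputable def A2J (D : ℕ) : Module.End ℂ (X D →₀ ℂ) :=
  opOfBasis fun x => ∑ y with y.card = x.card ∧ R 2 x y, Finsupp.single y 1

/-- The part `A₂^J̄` of the second distance operator between different levels. -/
noncomputable def A2Jbar (D : ℕ) : Module.End ℂ (X D →₀ ℂ) :=
  opOfBasis fun x => ∑ y with y.card ≠ x.card ∧ R 2 x y, Finsupp.single y 1

/-- The second dual distance operator `A₂^*` with respect to `∅`. -/
noncomputable def A2star (D : ℕ) : Module.End ℂ (X D →₀ ℂ) :=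
  opOfBasis fun x =>
    ((((D : ℂ) - 2 * (x.card : ℂ)) ^ 2 - (D : ℂ)) / 2) • Finsupp.single x 1

/-- The algebra generated by `A₂^J`, `A₂^J̄`, `A₂^*`. -/
noncomputable def algR (D : ℕ) : Subalgebra ℂ (Module.End ℂ (X D →₀ ℂ)) :=
  Algebra.adjoin ℂ {A2J D, A2Jbar D, A2star D}

/-- The even subsets. -/
def Xe (D : ℕ) : Set (X D) := {x | Even x.card}

/-- The subspace `ℂ^{X_e}` of `ℂ^X`. -/
noncomputable def CXe (D : ℕ) : Submodule ℂ (X D →₀ ℂ) := Finsupp.supported ℂ ℂ (Xe D)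

/-- The halved cube `½H(D,2)`, with vertex set `X_e`. -/
def halvedGraph (D : ℕ) : SimpleGraph (Xe D) where
  Adj x y := R 2 (x : X D) (y : X D)
  symm := ⟨fun x y h => by rw [R, SimpleGraph.dist_comm]; exact h⟩
  loopless := ⟨fun x h => by simp [R] at h⟩

/-- The empty set as a vertex of the halved cube. -/
def emptyVertex (D : ℕ) : Xe D := ⟨∅, by simp [Xe]⟩

noncomputable instance (D : ℕ) : Fintype (Xe D) := Fintype.ofFinite _

/-! ### The action of `U(sl₂)` on `ℂ^X` -/

theorem opE_single {D : ℕ} (x : X D) :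
    opE D (Finsupp.single x 1) = ∑ a ∈ x, Finsupp.single (x.erase a) 1 := by
  have h : (univ.filter fun y : X D => y.card < x.card ∧ R 1 x y)
      = x.image (fun a => x.erase a) := by
    ext y
    rw [mem_filter, R, SimpleGraph.dist_eq_one_iff_adj]
    simp only [mem_univ, true_and, mem_image, graph]
    rw [← Finset.covBy_iff_exists_erase]
    constructor
    · rintro ⟨h1, h2 | h2⟩
      · exact absurd h2.card_finset.lt (by omega)
      · exact h2
    · intro h
      exact ⟨h.card_finset.lt, Or.inr h⟩
  rw [opE, opOfBasis_single, h, sum_image]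
  intro a ha b hb hab
  exact Finset.erase_injOn x ha hb hab

theorem opF_single {D : ℕ} (x : X D) :
    opF D (Finsupp.single x 1) = ∑ a ∈ xᶜ, Finsupp.single (insert a x) 1 := by
  have h : (univ.filter fun y : X D => x.card < y.card ∧ R 1 x y)
      = xᶜ.image (fun a => insert a x) := by
    ext y
    rw [mem_filter, R, SimpleGraph.dist_eq_one_iff_adj]
    simp only [mem_univ, true_and, mem_image, graph, mem_compl]
    rw [← Finset.covBy_iff_exists_insert]
    constructor
    · rintro ⟨h1, h2 | h2⟩
      · exact h2
      · exact absurd h2.card_finset.lt (by omega)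
    · intro h
      exact ⟨h.card_finset.lt, Or.inl h⟩
  rw [opF, opOfBasis_single, h, sum_image]
  intro a ha b hb hab
  have ha' : a ∉ x := by simpa using ha
  have hab' : insert a x = insert b x := hab
  have h1 : a ∈ insert b x := hab' ▸ mem_insert_self a x
  rcases mem_insert.1 h1 with h1 | h1
  · exact h1
  · exact absurd h1 ha'

theorem opH_single {D : ℕ} (x : X D) :
    opH D (Finsupp.single x 1) = ((D : ℂ) - 2 * (x.card : ℂ)) • Finsupp.single x 1 := by
  rw [opH, opOfBasis_single]

theorem end_ext {D : ℕ} {f g : Module.End ℂ (X D →₀ ℂ)}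
    (h : ∀ x, f (Finsupp.single x 1) = g (Finsupp.single x 1)) : f = g := by
  refine Finsupp.lhom_ext' fun x => LinearMap.ext_ring ?_
  simpa using h x

theorem op_HE (D : ℕ) : opH D * opE D - opE D * opH D = (2 : ℂ) • opE D := by
  refine end_ext fun x => ?_
  simp only [LinearMap.sub_apply, Module.End.mul_apply, LinearMap.smul_apply, opH_single,
    opE_single, map_sum, map_smul]
  rw [smul_sum, smul_sum, ← sum_sub_distrib]
  refine sum_congr rfl fun a ha => ?_
  rw [← sub_smul, card_erase_of_mem ha]
  congr 1
  have : 1 ≤ x.card := card_pos.2 ⟨a, ha⟩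
  push_cast [Nat.cast_sub this]
  ring

theorem op_HF (D : ℕ) : opH D * opF D - opF D * opH D = (-2 : ℂ) • opF D := by
  refine end_ext fun x => ?_
  simp only [LinearMap.sub_apply, Module.End.mul_apply, LinearMap.smul_apply, opH_single,
    opF_single, map_sum, map_smul]
  rw [smul_sum, smul_sum, ← sum_sub_distrib]
  refine sum_congr rfl fun a ha => ?_
  rw [← sub_smul, card_insert_of_notMem (by simpa using ha)]
  congr 1
  push_cast
  ring

theorem op_EF (D : ℕ) : opE D * opF D - opF D * opE D = opH D := by
  refine end_ext fun x => ?_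
  simp only [LinearMap.sub_apply, Module.End.mul_apply, opH_single,
    opE_single, opF_single, map_sum]
  have h1 : ∀ a ∈ xᶜ, (∑ b ∈ insert a x, Finsupp.single ((insert a x).erase b) (1 : ℂ))
      = Finsupp.single x 1 + ∑ b ∈ x, Finsupp.single (insert a (x.erase b)) 1 := by
    intro a ha
    have ha' : a ∉ x := by simpa using ha
    rw [sum_insert ha', erase_insert ha']
    congr 1
    refine sum_congr rfl fun b hb => ?_
    rw [erase_insert_of_ne]
    rintro rfl
    exact ha' hb
  have h2 : ∀ b ∈ x, (∑ a ∈ (x.erase b)ᶜ, Finsupp.single (insert a (x.erase b)) (1 : ℂ))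
      = Finsupp.single x 1 + ∑ a ∈ xᶜ, Finsupp.single (insert a (x.erase b)) 1 := by
    intro b hb
    have : (x.erase b)ᶜ = insert b xᶜ := by
      ext c; simp only [mem_compl, mem_erase, mem_insert]; tauto
    rw [this, sum_insert (by simpa using hb), insert_erase hb]
  rw [sum_congr rfl h1, sum_congr rfl h2, sum_add_distrib, sum_add_distrib, sum_const, sum_const,
    sum_comm (s := x), card_compl, Fintype.card_fin]
  rw [add_sub_add_right_eq_sub, ← Nat.cast_smul_eq_nsmul ℂ, ← Nat.cast_smul_eq_nsmul ℂ, ← sub_smul]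
  congr 1
  have : x.card ≤ D := by simpa using card_le_univ x
  push_cast [Nat.cast_sub this]
  ring

/-- The representation of `U(sl₂)` on `ℂ^X`. -/
noncomputable def rep (D : ℕ) : SlTwo.U →ₐ[ℂ] Module.End ℂ (X D →₀ ℂ) :=
  SlTwo.lift (opE D) (opF D) (opH D) (op_HE D) (op_HF D) (op_EF D)

/-! ### Restriction to `ℂ^{X_e}` -/

theorem single_mem_supported {D : ℕ} {s : Set (X D)} {y : X D} (hy : y ∈ s) :
    (Finsupp.single y 1 : X D →₀ ℂ) ∈ Finsupp.supported ℂ ℂ s :=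
  Finsupp.single_mem_supported ℂ _ hy

theorem map_supported {D : ℕ} {f : Module.End ℂ (X D →₀ ℂ)} {s t : Set (X D)}
    (h : ∀ x ∈ s, f (Finsupp.single x 1) ∈ Finsupp.supported ℂ ℂ t) {v : X D →₀ ℂ}
    (hv : v ∈ Finsupp.supported ℂ ℂ s) : f v ∈ Finsupp.supported ℂ ℂ t := by
  rw [Finsupp.supported_eq_span_single] at hv
  induction hv using Submodule.span_induction with
  | mem w hw => obtain ⟨x, hx, rfl⟩ := hw; exact h x hx
  | zero => simp
  | add a b _ _ ha hb => rw [map_add]; exact add_mem ha hb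
  | smul c a _ ha => rw [map_smul]; exact Submodule.smul_mem _ _ ha

/-- The subsets `x` with `|x| + p` even. -/
def parity (D p : ℕ) : Set (X D) := {x | Even (x.card + p)}

theorem opE_parity {D p : ℕ} {v : X D →₀ ℂ} (hv : v ∈ Finsupp.supported ℂ ℂ (parity D p)) :
    opE D v ∈ Finsupp.supported ℂ ℂ (parity D (p + 1)) := by
  refine map_supported (fun x hx => ?_) hv
  rw [opE_single]
  refine sum_mem fun a ha => single_mem_supported ?_
  have h1 : 1 ≤ x.card := card_pos.2 ⟨a, ha⟩
  have h2 : Even (x.card + p) := hx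
  have h3 : (x.erase a).card + (p + 1) = x.card + p := by rw [card_erase_of_mem ha]; omega
  simpa [parity, h3] using h2

theorem opF_parity {D p : ℕ} {v : X D →₀ ℂ} (hv : v ∈ Finsupp.supported ℂ ℂ (parity D p)) :
    opF D v ∈ Finsupp.supported ℂ ℂ (parity D (p + 1)) := by
  refine map_supported (fun x hx => ?_) hv
  rw [opF_single]
  refine sum_mem fun a ha => single_mem_supported ?_
  have h2 : Even (x.card + p) := hx
  have h3 : (insert a x).card + (p + 1) = x.card + p + 2 := by
    rw [card_insert_of_notMem (by simpa using ha)]; omega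
  change Even _
  rw [h3]
  exact h2.add even_two

theorem opH_parity {D p : ℕ} {v : X D →₀ ℂ} (hv : v ∈ Finsupp.supported ℂ ℂ (parity D p)) :
    opH D v ∈ Finsupp.supported ℂ ℂ (parity D p) := by
  refine map_supported (fun x hx => ?_) hv
  rw [opH_single]
  exact Submodule.smul_mem _ _ (single_mem_supported hx)

theorem CXe_eq_parity (D p : ℕ) (hp : Even p) :
    CXe D = Finsupp.supported ℂ ℂ (parity D p) := by
  have : Xe D = parity D p := by
    ext x; simp [Xe, parity, Nat.even_add, hp]
  rw [CXe, this]

theorem rep_mem_invariant {D : ℕ} {u : SlTwo.U} (hu : u ∈ SlTwo.Ue) :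
    rep D u ∈ invariantSubalgebra (CXe D) := by
  rw [SlTwo.mem_Ue] at hu
  induction hu using Submodule.iSup_induction' with
  | zero => rw [map_zero]; exact zero_mem _
  | add a b _ _ ha hb => rw [map_add]; exact add_mem ha hb
  | mem n u hu =>
    induction hu using Submodule.span_induction with
    | zero => rw [map_zero]; exact zero_mem _
    | add a b _ _ ha hb => rw [map_add]; exact add_mem ha hb
    | smul c a _ ha => rw [map_smul]; exact Subalgebra.smul_mem _ ha c
    | mem u hu =>
      obtain ⟨i, j, k, hn, rfl⟩ := hu
      intro v hv
      have hH : ∀ k : ℕ, (opH D ^ k) v ∈ Finsupp.supported ℂ ℂ (parity D 0) := by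
        intro k
        induction k with
        | zero => simpa [← CXe_eq_parity D 0 (by simp)] using hv
        | succ k ih => rw [pow_succ', Module.End.mul_apply]; exact opH_parity ih
      have hF : ∀ j : ℕ, (opF D ^ j) ((opH D ^ k) v) ∈ Finsupp.supported ℂ ℂ (parity D j) := by
        intro j
        induction j with
        | zero => exact hH k
        | succ j ih => rw [pow_succ', Module.End.mul_apply]; exact opF_parity ih
      have hE : ∀ i : ℕ, (opE D ^ i) ((opF D ^ j) ((opH D ^ k) v))
          ∈ Finsupp.supported ℂ ℂ (parity D (j + i)) := by
        intro i
        induction i with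
        | zero => exact hF j
        | succ i ih => rw [pow_succ', Module.End.mul_apply]; exact opE_parity ih
      have hp : Even (j + i) := by rw [Nat.even_iff]; omega
      rw [CXe_eq_parity D (j + i) hp]
      simpa [rep] using hE i

theorem even_of_R_two {D : ℕ} {x y : X D} (h : R 2 x y) (hx : x ∈ Xe D) : y ∈ Xe D := by
  have hadj : ∀ a b : X D, (graph D).Adj a b → (Even a.card ↔ ¬ Even b.card) := by
    intro a b hab
    rcases hab with hab | hab
    · have := Order.covBy_iff_add_one_eq.1 hab.card_finset
      rw [← this, Nat.even_add_one, not_not]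
    · have := Order.covBy_iff_add_one_eq.1 hab.card_finset
      rw [← this, Nat.even_add_one]
  have hr : (graph D).Reachable x y := by
    by_contra hr
    rw [R, SimpleGraph.dist_eq_zero_of_not_reachable hr] at h
    omega
  obtain ⟨w, hw⟩ := hr.exists_walk_length_eq_dist
  have hw2 : w.length = 2 := hw.trans h
  have hx' : Even x.card := hx
  have e : ∃ z, (graph D).Adj x z ∧ (graph D).Adj z y := by
    cases w with
    | nil => simp at hw2
    | cons h1 w =>
      cases w with
      | nil => simp at hw2
      | cons h2 w =>
        cases w with
        | nil => exact ⟨_, h1, h2⟩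
        | cons h3 w => simp at hw2
  obtain ⟨z, h1, h2⟩ := e
  have a1 := hadj _ _ h1
  have a2 := hadj _ _ h2
  change Even y.card
  tauto

theorem algR_le_invariant (D : ℕ) : algR D ≤ invariantSubalgebra (CXe D) := by
  rw [algR, Algebra.adjoin_le_iff]
  intro f hf
  simp only [Set.mem_insert_iff, Set.mem_singleton_iff] at hf
  rcases hf with rfl | rfl | rfl
  · intro v hv
    refine map_supported (fun x hx => ?_) hv
    rw [A2J, opOfBasis_single]
    exact sum_mem fun y hy => single_mem_supported (even_of_R_two (mem_filter.1 hy).2.2 hx)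
  · intro v hv
    refine map_supported (fun x hx => ?_) hv
    rw [A2Jbar, opOfBasis_single]
    exact sum_mem fun y hy => single_mem_supported (even_of_R_two (mem_filter.1 hy).2.2 hx)
  · intro v hv
    refine map_supported (fun x hx => ?_) hv
    rw [A2star, opOfBasis_single]
    exact Submodule.smul_mem _ _ (single_mem_supported hx)

/-- The representation of `U(sl₂)_e` on `ℂ^{X_e}`. -/
noncomputable def repE (D : ℕ) : SlTwo.Ue →ₐ[ℂ] Module.End ℂ (CXe D) :=
  (restrictHom (CXe D)).comp
    (((rep D).comp SlTwo.Ue.val).codRestrict (invariantSubalgebra (CXe D))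
      fun u => rep_mem_invariant u.2)

/-- `T_e`, the image of `U(sl₂)_e` in `End(ℂ^{X_e})`. -/
noncomputable def Te (D : ℕ) : Subalgebra ℂ (Module.End ℂ (CXe D)) := (repE D).range

/-- `R_e = {M|_{ℂ^{X_e}} | M ∈ R}`. -/
noncomputable def Re (D : ℕ) : Subalgebra ℂ (Module.End ℂ (CXe D)) :=
  ((restrictHom (CXe D)).comp (Subalgebra.inclusion (algR_le_invariant D))).range

/-- The identification of `End(ℂ^{X_e})`, for `ℂ^{X_e}` as a subspace of `ℂ^X`, with the
endomorphisms of the space with basis `X_e`. -/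
noncomputable def endEquiv (D : ℕ) :
    Module.End ℂ (CXe D) ≃ₐ[ℂ] Module.End ℂ (Xe D →₀ ℂ) :=
  (Finsupp.supportedEquivFinsupp (M := ℂ) (R := ℂ) (Xe D)).conjAlgEquiv ℂ

end Hypercube

namespace Hypercube

open Finset
open scoped symmDiff

/-! Everything rests on three identities on `ℂ^X`: `EF = A₂^J + (H + D)/2`, `E² + F² = 2 A₂^J̄` and
`A₂^* = (H² - D)/2` (`opE_mul_opF`, `opE_sq_add_opF_sq`, `A2star_eq`). In a monomial `E^i F^j H^k`
with `i - j` even, the part `E^i F^j` is a product of copies of `E²`, `F²` and at most one `EF`.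
Bracketing with `H` multiplies `E²` by `4` and `F²` by `-4`, so `H` and `A₂^J̄` recover `E²` and
`F²` separately. Hence the image of `U(sl₂)_e` on `ℂ^X` is the algebra generated by `A₂^J`, `A₂^J̄`
and `H` (`rep_Ue`), which contains `A₂^*`; this gives `R_e ≤ T_e`.

The only possible gap between `R_e` and `T_e` is therefore `H` versus `H²` on the even levels. Two
levels `k ≠ l` have the same value of `(D - 2k)²` exactly when `k + l = D`. For odd `D` this cannot
happen with `k`, `l` both even, so `H` is a polynomial in `A₂^*` on `ℂ^{X_e}` (`Te_le_Re`). For even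
`D ≠ 0`, complementation preserves `X_e` and commutes with all of `R`, but turns `H` into `-H`, so
`H` is not in `R_e` (`Re_ne_Te`).

For the halved cube, the distance from `∅` to `x` is `|x|/2` (`halvedGraph_dist`). Thus the dual
idempotents are polynomials in the restriction of `H`, which is in turn a combination of them. The
adjacency operator is the restriction of `A = A₂^J + A₂^J̄`, and `[H,[H,A]] = 16 A₂^J̄` splits it
into its two summands (`map_Te_eq_terwilligerAlgebra`). -/

/-! ### Adjacency and distance two in the hypercube via symmetric differences -/

theorem graph_adj_iff {D : ℕ} {x y : X D} : (graph D).Adj x y ↔ ∃ a, y = x ∆ {a} := by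
  change (x ⋖ y ∨ y ⋖ x) ↔ _
  rw [Finset.covBy_iff_exists_insert, Finset.covBy_iff_exists_erase]
  constructor
  · rintro (⟨a, ha, rfl⟩ | ⟨a, ha, rfl⟩) <;> refine ⟨a, ?_⟩ <;> ext c <;>
      by_cases hc : c = a <;> simp_all [mem_symmDiff]
  · rintro ⟨a, rfl⟩
    by_cases ha : a ∈ x
    · exact Or.inr ⟨a, ha, by ext c; by_cases hc : c = a <;> simp_all [mem_symmDiff]⟩
    · exact Or.inl ⟨a, ha, by ext c; by_cases hc : c = a <;> simp_all [mem_symmDiff]⟩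

theorem R_two_iff {D : ℕ} {x y : X D} : R 2 x y ↔ ∃ a b, a ≠ b ∧ y = x ∆ {a, b} := by
  have hab : ∀ a b : Fin D, a ≠ b → ({a, b} : X D) = {a} ∆ {b} := by
    intro a b h
    ext c
    simp only [mem_insert, mem_singleton, mem_symmDiff]
    grind
  constructor
  · intro h
    have hr : (graph D).Reachable x y := by
      -- Unreachable pairs have `dist` equal to `0`, so distance `2` forces a walk to exist.
      by_contra hr
      rw [R, SimpleGraph.dist_eq_zero_of_not_reachable hr] at h
      omega
    obtain ⟨w, hw⟩ := hr.exists_walk_length_eq_dist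
    have hw2 : w.length = 2 := hw.trans h
    obtain ⟨z, h1, h2⟩ : ∃ z, (graph D).Adj x z ∧ (graph D).Adj z y := by
      match w, hw2 with
      | .cons h1 (.cons h2 .nil), _ => exact ⟨_, h1, h2⟩
    obtain ⟨a, rfl⟩ := graph_adj_iff.1 h1
    obtain ⟨b, rfl⟩ := graph_adj_iff.1 h2
    have hne : a ≠ b := by
      rintro rfl
      simp [R] at h
    exact ⟨a, b, hne, by rw [hab a b hne, symmDiff_assoc]⟩
  · rintro ⟨a, b, hne, rfl⟩
    have h1 : (graph D).Adj x (x ∆ {a}) := graph_adj_iff.2 ⟨a, rfl⟩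
    have h2 : (graph D).Adj (x ∆ {a}) (x ∆ {a, b}) :=
      graph_adj_iff.2 ⟨b, by rw [hab a b hne, symmDiff_assoc]⟩
    have hle : (graph D).dist x (x ∆ {a, b}) ≤ 2 :=
      SimpleGraph.dist_le (.cons h1 (.cons h2 .nil))
    have h0 : (graph D).dist x (x ∆ {a, b}) ≠ 0 := by
      rw [Ne, (h1.reachable.trans h2.reachable).dist_eq_zero_iff]
      intro h
      have : ({a, b} : X D) = ⊥ := symmDiff_eq_left.1 h.symm
      simp at this
    -- Distance one would equate a two-element set with a singleton after cancelling `x`.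
    have h1' : (graph D).dist x (x ∆ {a, b}) ≠ 1 := by
      rw [Ne, SimpleGraph.dist_eq_one_iff_adj, graph_adj_iff]
      rintro ⟨c, hc⟩
      have := congrArg card (symmDiff_right_injective x hc)
      rw [card_pair hne, card_singleton] at this
      omega
    change (graph D).dist x (x ∆ {a, b}) = 2
    omega

/-! ### Quadratic expressions in `E`, `F`, `H` as distance-two operators -/

/-- Add an element, then remove one. Removing the element just added returns to `x` in `D - |x|`
ways, which is the eigenvalue of `(H + D)/2`; removing another one swaps an outside element for an
inside one, and each vertex of the same level at distance two is such a swap in exactly one way. -/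
theorem opE_mul_opF (D : ℕ) :
    opE D * opF D = A2J D + (2⁻¹ : ℂ) • (opH D + (D : ℂ) • 1) := by
  refine end_ext fun x => ?_
  have hset : (univ.filter fun y : X D => y.card = x.card ∧ R 2 x y)
      = (xᶜ ×ˢ x).image (fun p => insert p.1 (x.erase p.2)) := by
    ext y
    simp only [mem_filter, mem_univ, true_and, mem_image, mem_product, mem_compl, Prod.exists,
      R_two_iff]
    constructor
    · rintro ⟨hc, a, b, hne, rfl⟩
      by_cases ha : a ∈ x <;> by_cases hb : b ∈ x
      · have : x ∆ {a, b} = (x.erase a).erase b := by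
          ext c; simp only [mem_symmDiff, mem_insert, mem_singleton, mem_erase]; grind
        have hb' : b ∈ x.erase a := mem_erase.2 ⟨hne.symm, hb⟩
        have h1 := card_erase_lt_of_mem hb'
        have h2 := card_erase_lt_of_mem ha
        rw [this] at hc
        omega
      · refine ⟨b, a, ⟨hb, ha⟩, ?_⟩
        ext c; simp only [mem_symmDiff, mem_insert, mem_singleton, mem_erase]; grind
      · refine ⟨a, b, ⟨ha, hb⟩, ?_⟩
        ext c; simp only [mem_symmDiff, mem_insert, mem_singleton, mem_erase]; grind
      · have : x ∆ {a, b} = insert b (insert a x) := by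
          ext c; simp only [mem_symmDiff, mem_insert, mem_singleton]; grind
        rw [this, card_insert_of_notMem (by simp [hne.symm, hb]), card_insert_of_notMem ha] at hc
        omega
    · rintro ⟨a, b, ⟨ha, hb⟩, rfl⟩
      refine ⟨?_, a, b, by rintro rfl; exact ha hb, ?_⟩
      · rw [card_insert_of_notMem (by simp [ha]), card_erase_add_one hb]
      · ext c; simp only [mem_symmDiff, mem_insert, mem_singleton, mem_erase]; grind
  have hinj : Set.InjOn (fun p : Fin D × Fin D => insert p.1 (x.erase p.2))
      (xᶜ ×ˢ x : Finset _) := by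
    rintro ⟨a, b⟩ h1 ⟨c, d⟩ h2 h
    simp only [coe_product, Set.mem_prod, mem_coe, mem_compl] at h1 h2
    have hac := (Finset.ext_iff.1 h a)
    have hbd := (Finset.ext_iff.1 h b)
    simp only [mem_insert, mem_erase] at hac hbd
    simp only [Prod.mk.injEq]
    grind
  have h1 : ∀ a ∈ xᶜ, (∑ b ∈ insert a x, Finsupp.single ((insert a x).erase b) (1 : ℂ))
      = Finsupp.single x 1 + ∑ b ∈ x, Finsupp.single (insert a (x.erase b)) 1 := by
    intro a ha
    have ha' : a ∉ x := by simpa using ha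
    rw [sum_insert ha', erase_insert ha']
    congr 1
    refine sum_congr rfl fun b hb => ?_
    rw [erase_insert_of_ne]
    rintro rfl
    exact ha' hb
  simp only [Module.End.mul_apply, LinearMap.add_apply, LinearMap.smul_apply, Module.End.one_apply,
    opH_single, opF_single, map_sum, opE_single]
  rw [sum_congr rfl h1, sum_add_distrib, A2J, opOfBasis_single, hset, sum_image hinj, sum_product,
    sum_const, card_compl, Fintype.card_fin, add_comm]
  congr 1
  rw [← Nat.cast_smul_eq_nsmul ℂ, ← add_smul, smul_smul]
  congr 1
  have : x.card ≤ D := by simpa using card_le_univ x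
  push_cast [Nat.cast_sub this]
  ring

/-- Used for two successive removals or insertions: the order of the two moves is irrelevant to the
result, so the fibre of `g` through `(a, b)` on the off-diagonal is `{(a, b), (b, a)}`. -/
theorem sum_two_to_one {ι α M : Type*} [DecidableEq ι] [AddCommGroup M] [Module ℂ M]
    [DecidableEq α] (s : Finset ι) (g : ι → ι → α) (f : α → M) (t : Finset α)
    (ht : ∀ y, y ∈ t ↔ ∃ a ∈ s, ∃ b ∈ s, a ≠ b ∧ g a b = y)
    (hg : ∀ a ∈ s, ∀ b ∈ s, a ≠ b → ∀ c ∈ s, ∀ d ∈ s, c ≠ d →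
      (g c d = g a b ↔ (c = a ∧ d = b) ∨ (c = b ∧ d = a))) :
    ∑ a ∈ s, ∑ b ∈ s.erase a, f (g a b) = (2 : ℂ) • ∑ y ∈ t, f y := by
  have h1 : ∑ a ∈ s, ∑ b ∈ s.erase a, f (g a b) = ∑ p ∈ s.offDiag, f (g p.1 p.2) := by
    rw [sum_sigma']
    refine sum_nbij' (fun p => (p.1, p.2)) (fun p => ⟨p.1, p.2⟩) ?_ ?_ ?_ ?_ ?_ <;>
      simp +contextual [eq_comm]
  have h2 : t = s.offDiag.image fun p => g p.1 p.2 := by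
    ext y
    rw [ht]
    simp only [mem_image, mem_offDiag, Prod.exists]
    grind
  rw [h1, smul_sum, h2,
    sum_comp (f := f) (g := fun p : ι × ι => g p.1 p.2)]
  refine sum_congr rfl fun y hy => ?_
  obtain ⟨⟨a, b⟩, hp, rfl⟩ := mem_image.1 hy
  obtain ⟨ha, hb, hab⟩ := mem_offDiag.1 hp
  have h3 : (s.offDiag.filter fun p => g p.1 p.2 = g a b) = {(a, b), (b, a)} := by
    ext ⟨c, d⟩
    simp only [mem_filter, mem_offDiag, mem_insert, mem_singleton, Prod.mk.injEq]
    constructor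
    · rintro ⟨⟨hc, hd, hcd⟩, h⟩
      exact (hg a ha b hb hab c hc d hd hcd).1 h
    · intro h
      have hcd : c ∈ s ∧ d ∈ s ∧ c ≠ d := by
        rcases h with ⟨rfl, rfl⟩ | ⟨rfl, rfl⟩
        exacts [⟨ha, hb, hab⟩, ⟨hb, ha, hab.symm⟩]
      exact ⟨hcd, (hg a ha b hb hab c hcd.1 d hcd.2.1 hcd.2.2).2 h⟩
  rw [h3, card_pair (by simp [hab]), ← Nat.cast_smul_eq_nsmul ℂ, Nat.cast_ofNat]

theorem opE_mul_opE_single {D : ℕ} (x : X D) :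
    opE D (opE D (Finsupp.single x 1))
      = (2 : ℂ) • ∑ y with y.card < x.card ∧ R 2 x y, Finsupp.single y 1 := by
  simp only [opE_single, map_sum]
  refine sum_two_to_one x (fun a b => (x.erase a).erase b) (fun y => Finsupp.single y (1 : ℂ)) _
    (fun y => ?_) ?_
  · simp only [mem_filter, mem_univ, true_and, R_two_iff]
    constructor
    · rintro ⟨hc, a, b, hne, rfl⟩
      by_cases ha : a ∈ x
      · by_cases hb : b ∈ x
        · refine ⟨a, ha, b, hb, hne, ?_⟩
          ext c; simp only [mem_symmDiff, mem_insert, mem_singleton, mem_erase]; grind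
        · have : x ∆ {a, b} = insert b (x.erase a) := by
            ext c; simp only [mem_symmDiff, mem_insert, mem_singleton, mem_erase]; grind
          rw [this, card_insert_of_notMem (by simp [hb]), card_erase_add_one ha] at hc
          omega
      -- Here `a` is gained and at most `b` is lost, so the cardinality cannot drop, wherever `b`
      -- lies.
      · have h1 : x.erase b ⊆ x ∆ {a, b} := by
          intro c; simp only [mem_symmDiff, mem_insert, mem_singleton, mem_erase]; grind
        have h2 : insert a (x.erase b) ⊆ x ∆ {a, b} := by
          refine insert_subset ?_ h1
          simp [mem_symmDiff, ha]
        have h3 := card_le_card h2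
        rw [card_insert_of_notMem (by simp [ha])] at h3
        have h4 := pred_card_le_card_erase (s := x) (a := b)
        omega
    · rintro ⟨a, ha, b, hb, hab, rfl⟩
      refine ⟨card_lt_card ⟨(erase_subset _ _).trans (erase_subset _ _), fun h => ?_⟩, a, b, hab, ?_⟩
      · simpa using h hb
      · ext c; simp only [mem_symmDiff, mem_insert, mem_singleton, mem_erase]; grind
  · intro a ha b hb hab c hc d hd hcd
    constructor
    · intro h
      have h1 := Finset.ext_iff.1 h c
      have h2 := Finset.ext_iff.1 h d
      simp only [mem_erase] at h1 h2
      grind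
    · rintro (⟨rfl, rfl⟩ | ⟨rfl, rfl⟩)
      · rfl
      · exact erase_right_comm

theorem opF_mul_opF_single {D : ℕ} (x : X D) :
    opF D (opF D (Finsupp.single x 1))
      = (2 : ℂ) • ∑ y with x.card < y.card ∧ R 2 x y, Finsupp.single y 1 := by
  -- Puts the inner sum over elements still outside into the form that `sum_two_to_one` expects.
  have hcompl : ∀ a, (insert a x)ᶜ = xᶜ.erase a := fun a => by
    ext c; simp
  simp only [opF_single, map_sum, hcompl]
  refine sum_two_to_one xᶜ (fun a b => insert b (insert a x))
    (fun y => Finsupp.single y (1 : ℂ)) _ (fun y => ?_) ?_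
  · simp only [mem_filter, mem_univ, true_and, R_two_iff, mem_compl]
    constructor
    · rintro ⟨hc, a, b, hne, rfl⟩
      by_cases ha : a ∈ x
      · have h2 : x ∆ {a, b} ⊆ insert b (x.erase a) := by
          intro c; simp only [mem_symmDiff, mem_insert, mem_singleton, mem_erase]; grind
        have h3 := card_le_card h2
        have h4 := card_insert_le b (x.erase a)
        rw [card_erase_add_one ha] at h4
        omega
      · by_cases hb : b ∈ x
        · have : x ∆ {a, b} = insert a (x.erase b) := by
            ext c; simp only [mem_symmDiff, mem_insert, mem_singleton, mem_erase]; grind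
          rw [this, card_insert_of_notMem (by simp [ha]), card_erase_add_one hb] at hc
          omega
        · refine ⟨a, ha, b, hb, hne, ?_⟩
          ext c; simp only [mem_symmDiff, mem_insert, mem_singleton]; grind
    · rintro ⟨a, ha, b, hb, hab, rfl⟩
      refine ⟨card_lt_card ⟨(subset_insert _ _).trans (subset_insert _ _), fun h => ?_⟩, a, b, hab,
        ?_⟩
      · exact hb (h (mem_insert_self _ _))
      · ext c; simp only [mem_symmDiff, mem_insert, mem_singleton]; grind
  · intro a ha b hb hab c hc d hd hcd
    simp only [mem_compl] at ha hb hc hd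
    constructor
    · intro h
      have h1 := Finset.ext_iff.1 h c
      have h2 := Finset.ext_iff.1 h d
      simp only [mem_insert] at h1 h2
      grind
    · rintro (⟨rfl, rfl⟩ | ⟨rfl, rfl⟩)
      · rfl
      · exact insert_comm _ _ _

theorem opE_sq_add_opF_sq (D : ℕ) :
    opE D * opE D + opF D * opF D = (2 : ℂ) • A2Jbar D := by
  refine end_ext fun x => ?_
  rw [LinearMap.add_apply, Module.End.mul_apply, Module.End.mul_apply, LinearMap.smul_apply,
    opE_mul_opE_single, opF_mul_opF_single, A2Jbar, opOfBasis_single, ← smul_add, ← sum_union]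
  · congr 2
    ext y
    simp only [mem_union, mem_filter, mem_univ, true_and, ne_iff_lt_or_gt]
    tauto
  · rw [disjoint_filter]
    intro y _ h1 h2
    exact absurd h1.1 h2.1.asymm

theorem A2star_eq (D : ℕ) : A2star D = (2⁻¹ : ℂ) • (opH D * opH D - (D : ℂ) • 1) := by
  refine end_ext fun x => ?_
  simp only [A2star, opOfBasis_single, LinearMap.smul_apply, LinearMap.sub_apply,
    Module.End.mul_apply, opH_single, map_smul, Module.End.one_apply]
  rw [smul_smul, ← sub_smul, smul_smul]
  congr 1
  ring

/-! ### The image of the even subalgebra on the full space -/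

/-- The algebra generated by `A₂^J`, `A₂^J̄` and `H`. -/
noncomputable def algT (D : ℕ) : Subalgebra ℂ (Module.End ℂ (X D →₀ ℂ)) :=
  Algebra.adjoin ℂ {A2J D, A2Jbar D, opH D}

theorem A2J_mem_algT (D : ℕ) : A2J D ∈ algT D := Algebra.subset_adjoin (by simp)
theorem A2Jbar_mem_algT (D : ℕ) : A2Jbar D ∈ algT D := Algebra.subset_adjoin (by simp)
theorem opH_mem_algT (D : ℕ) : opH D ∈ algT D := Algebra.subset_adjoin (by simp)

theorem smul_one_mem {A : Type*} [Semiring A] [Algebra ℂ A] (S : Subalgebra ℂ A) (c : ℂ) :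
    c • (1 : A) ∈ S := S.smul_mem S.one_mem c

theorem end_sub_mem {α : Type*} {S : Subalgebra ℂ (Module.End ℂ (α →₀ ℂ))}
    {f g : Module.End ℂ (α →₀ ℂ)} (hf : f ∈ S) (hg : g ∈ S) : f - g ∈ S := by
  have h : f - g = f + (-1 : ℂ) • g := by module
  rw [h]
  exact add_mem hf (S.smul_mem hg _)

theorem opE_mul_opF_mem (D : ℕ) : opE D * opF D ∈ algT D := by
  rw [opE_mul_opF]
  exact add_mem (A2J_mem_algT D)
    ((algT D).smul_mem (add_mem (opH_mem_algT D) (smul_one_mem _ _)) _)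

theorem A2Jbar_eq (D : ℕ) : A2Jbar D = (2⁻¹ : ℂ) • (opE D * opE D + opF D * opF D) := by
  rw [opE_sq_add_opF_sq, smul_smul]; norm_num

theorem opH_mul_opE_sq (D : ℕ) :
    opH D * (opE D * opE D) = opE D * opE D * opH D + (4 : ℂ) • (opE D * opE D) := by
  have hE : opH D * opE D = opE D * opH D + (2 : ℂ) • opE D := by rw [← op_HE]; abel
  rw [← mul_assoc, hE, add_mul, mul_assoc, hE, mul_add, smul_mul_assoc, mul_smul_comm, mul_assoc]
  module

theorem opH_mul_opF_sq (D : ℕ) :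
    opH D * (opF D * opF D) = opF D * opF D * opH D + (-4 : ℂ) • (opF D * opF D) := by
  have hF : opH D * opF D = opF D * opH D + (-2 : ℂ) • opF D := by rw [← op_HF]; abel
  rw [← mul_assoc, hF, add_mul, mul_assoc, hF, mul_add, smul_mul_assoc, mul_smul_comm, mul_assoc]
  module

theorem commutator_opH_A2Jbar (D : ℕ) :
    opH D * A2Jbar D - A2Jbar D * opH D = (2 : ℂ) • (opE D * opE D - opF D * opF D) := by
  rw [A2Jbar_eq, mul_smul_comm, smul_mul_assoc, mul_add, add_mul, opH_mul_opE_sq, opH_mul_opF_sq]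
  module

theorem commutator_opH_A2J (D : ℕ) : opH D * A2J D = A2J D * opH D := by
  refine end_ext fun x => ?_
  simp only [Module.End.mul_apply, opH_single, A2J, opOfBasis_single, map_sum, map_smul, smul_sum]
  refine sum_congr rfl fun y hy => ?_
  rw [(mem_filter.1 hy).2.1]

/-- `E²` and `F²` are eigenvectors of the bracket with `H` for `4` and `-4`; squaring the bracket
removes the sign, so their sum is an eigenvector for `16`. -/
theorem commutator_commutator (D : ℕ) :
    opH D * (opH D * A2Jbar D - A2Jbar D * opH D) - (opH D * A2Jbar D - A2Jbar D * opH D) * opH D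
      = (16 : ℂ) • A2Jbar D := by
  have h1 : opH D * (opE D * opE D - opF D * opF D) = opH D * (opE D * opE D)
      - opH D * (opF D * opF D) := LinearMap.comp_sub _ _ _
  have h2 : (opE D * opE D - opF D * opF D) * opH D = opE D * opE D * opH D
      - opF D * opF D * opH D := LinearMap.sub_comp _ _ _
  rw [commutator_opH_A2Jbar, A2Jbar_eq, mul_smul_comm, smul_mul_assoc, h1, h2, opH_mul_opE_sq,
    opH_mul_opF_sq]
  module

/-- Half the sum plus half the difference of `E²` and `F²`, the difference being supplied by the
bracket with `H`. -/
theorem opE_sq_eq (D : ℕ) :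
    opE D * opE D = A2Jbar D + (4⁻¹ : ℂ) • (opH D * A2Jbar D - A2Jbar D * opH D) := by
  rw [commutator_opH_A2Jbar]
  rw [A2Jbar_eq]
  module

theorem opE_sq_mem (D : ℕ) : opE D * opE D ∈ algT D := by
  have hA := A2Jbar_mem_algT D
  have hH := opH_mem_algT D
  rw [opE_sq_eq]
  exact add_mem hA ((algT D).smul_mem (end_sub_mem (mul_mem hH hA) (mul_mem hA hH)) _)

theorem opF_sq_mem (D : ℕ) : opF D * opF D ∈ algT D := by
  have h : opF D * opF D = (2 : ℂ) • A2Jbar D - opE D * opE D := by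
    rw [← opE_sq_add_opF_sq]; abel
  rw [h]
  exact end_sub_mem ((algT D).smul_mem (A2Jbar_mem_algT D) _) (opE_sq_mem D)

theorem rep_Ue (D : ℕ) : SlTwo.Ue.map (rep D) = algT D := by
  apply le_antisymm
  · rintro _ ⟨u, hu, rfl⟩
    change rep D u ∈ algT D
    have hu' : u ∈ ⨆ n : ℤ, SlTwo.homogeneous (2 * n) := hu
    clear hu
    induction hu' using Submodule.iSup_induction' with
    | zero => rw [map_zero]; exact zero_mem _
    | add a b ha hb iha ihb => rw [map_add]; exact add_mem iha ihb
    | mem n u hu =>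
      induction hu using Submodule.span_induction with
      | zero => rw [map_zero]; exact zero_mem _
      | add a b ha hb iha ihb =>
        rw [map_add]
        exact add_mem iha ihb
      | smul c a ha iha =>
        rw [map_smul]; exact (algT D).smul_mem iha c
      | mem u hu =>
        obtain ⟨i, j, k, hn, rfl⟩ := hu
        have e : rep D (SlTwo.E ^ i * SlTwo.F ^ j * SlTwo.H ^ k)
            = opE D ^ i * opF D ^ j * opH D ^ k := by simp [rep]
        rw [e]
        refine mul_mem ?_ (pow_mem (opH_mem_algT D) k)
        have hE : ∀ m : ℕ, opE D ^ (2 * m) ∈ algT D := fun m => by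
          rw [pow_mul, sq]; exact pow_mem (opE_sq_mem D) m
        have hF : ∀ m : ℕ, opF D ^ (2 * m) ∈ algT D := fun m => by
          rw [pow_mul, sq]; exact pow_mem (opF_sq_mem D) m
        -- Since `i - j` is even, the mixed parities are impossible. When both exponents are odd,
        -- one `E` and one `F` meet in the middle: `E^(2p) (EF) F^(2q)`.
        rcases Nat.even_or_odd' i with ⟨p, rfl | rfl⟩ <;>
          rcases Nat.even_or_odd' j with ⟨q, rfl | rfl⟩
        · exact mul_mem (hE p) (hF q)
        · omega
        · omega
        · rw [pow_succ, pow_succ', mul_assoc, ← mul_assoc (opE D) (opF D)]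
          exact mul_mem (hE p) (mul_mem (opE_mul_opF_mem D) (hF q))
  · have hEE : SlTwo.E * SlTwo.E ∈ SlTwo.Ue :=
      Submodule.mem_iSup_of_mem 1 (Submodule.subset_span ⟨2, 0, 0, by norm_num, by simp [sq]⟩)
    have hFF : SlTwo.F * SlTwo.F ∈ SlTwo.Ue :=
      Submodule.mem_iSup_of_mem (-1) (Submodule.subset_span ⟨0, 2, 0, by norm_num, by simp [sq]⟩)
    have hEF : SlTwo.E * SlTwo.F ∈ SlTwo.Ue :=
      Submodule.mem_iSup_of_mem 0 (Submodule.subset_span ⟨1, 1, 0, by norm_num, by simp⟩)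
    have hH : SlTwo.H ∈ SlTwo.Ue :=
      Submodule.mem_iSup_of_mem 0 (Submodule.subset_span ⟨0, 0, 1, by norm_num, by simp⟩)
    have hEE' : opE D * opE D ∈ SlTwo.Ue.map (rep D) := ⟨_, hEE, by simp [rep]⟩
    have hFF' : opF D * opF D ∈ SlTwo.Ue.map (rep D) := ⟨_, hFF, by simp [rep]⟩
    have hEF' : opE D * opF D ∈ SlTwo.Ue.map (rep D) := ⟨_, hEF, by simp [rep]⟩
    have hH' : opH D ∈ SlTwo.Ue.map (rep D) := ⟨_, hH, by simp [rep]⟩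
    rw [algT, Algebra.adjoin_le_iff]
    intro f hf
    simp only [Set.mem_insert_iff, Set.mem_singleton_iff] at hf
    rcases hf with rfl | rfl | rfl
    · have h : A2J D = opE D * opF D - (2⁻¹ : ℂ) • (opH D + (D : ℂ) • 1) := by
        rw [opE_mul_opF]; abel
      rw [h]
      exact end_sub_mem hEF' (Subalgebra.smul_mem _ (add_mem hH' (smul_one_mem _ _)) _)
    · have h3 : A2Jbar D = (2⁻¹ : ℂ) • (opE D * opE D + opF D * opF D) := by
        rw [opE_sq_add_opF_sq, smul_smul]; norm_num
      rw [A2Jbar_eq]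
      exact Subalgebra.smul_mem _ (add_mem hEE' hFF') _
    · exact hH'

theorem algR_le_algT (D : ℕ) : algR D ≤ algT D := by
  rw [algR, Algebra.adjoin_le_iff]
  intro f hf
  simp only [Set.mem_insert_iff, Set.mem_singleton_iff] at hf
  rcases hf with rfl | rfl | rfl
  · exact A2J_mem_algT D
  · exact A2Jbar_mem_algT D
  · rw [A2star_eq]
    exact Subalgebra.smul_mem _ (end_sub_mem (mul_mem (opH_mem_algT D) (opH_mem_algT D))
      (smul_one_mem _ _)) _

/-! ### Restriction to `ℂ^{X_e}` and the inclusion of `R_e` in `T_e` -/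

theorem algT_le_invariant (D : ℕ) : algT D ≤ invariantSubalgebra (CXe D) := by
  rw [← rep_Ue]
  rintro _ ⟨u, hu, rfl⟩
  exact rep_mem_invariant hu

/-- By `rep_Ue` the enveloping algebra can be dropped: from here on `T_e` is handled through the
three generators of `algT D`. -/
theorem mem_Te {D : ℕ} {M : Module.End ℂ (CXe D)} :
    M ∈ Te D ↔ ∃ f, ∃ hf : f ∈ algT D, M = restrictHom (CXe D) ⟨f, algT_le_invariant D hf⟩ := by
  constructor
  · rintro ⟨u, rfl⟩
    exact ⟨rep D u, by rw [← rep_Ue]; exact ⟨u, u.2, rfl⟩, rfl⟩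
  · rintro ⟨f, hf, rfl⟩
    have hf' := hf
    rw [← rep_Ue] at hf'
    obtain ⟨u, hu, rfl⟩ := hf'
    exact ⟨⟨u, hu⟩, rfl⟩

theorem mem_Re {D : ℕ} {M : Module.End ℂ (CXe D)} :
    M ∈ Re D ↔ ∃ f, ∃ hf : f ∈ algR D, M = restrictHom (CXe D) ⟨f, algR_le_invariant D hf⟩ := by
  constructor
  · rintro ⟨f, rfl⟩
    exact ⟨f, f.2, rfl⟩
  · rintro ⟨f, hf, rfl⟩
    exact ⟨⟨f, hf⟩, rfl⟩

theorem Re_le_Te (D : ℕ) : Re D ≤ Te D := by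
  intro M hM
  obtain ⟨f, hf, rfl⟩ := mem_Re.1 hM
  exact mem_Te.2 ⟨f, algR_le_algT D hf, rfl⟩

/-- A homomorphism on the operators preserving `ℂ^{X_e}` maps `algT D` into a subalgebra as soon
as it does so for the generators. -/
theorem map_algT_mem {D : ℕ} {A : Type*} [Semiring A] [Algebra ℂ A]
    (φ : invariantSubalgebra (CXe D) →ₐ[ℂ] A) (S : Subalgebra ℂ A)
    (h1 : φ ⟨A2J D, algT_le_invariant D (A2J_mem_algT D)⟩ ∈ S)
    (h2 : φ ⟨A2Jbar D, algT_le_invariant D (A2Jbar_mem_algT D)⟩ ∈ S)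
    (h3 : φ ⟨opH D, algT_le_invariant D (opH_mem_algT D)⟩ ∈ S)
    {f : Module.End ℂ (X D →₀ ℂ)} (hf : f ∈ algT D) :
    φ ⟨f, algT_le_invariant D hf⟩ ∈ S := by
  -- `φ` is defined only on the invariant operators, while `algT D` is generated inside all
  -- operators. Pulling `S` back along `φ` and including the result in the full operator algebra
  -- lets the generators be checked there.
  have h : algT D ≤ (S.comap φ).map (invariantSubalgebra (CXe D)).val := by
    rw [algT, Algebra.adjoin_le_iff]
    intro f hf
    simp only [Set.mem_insert_iff, Set.mem_singleton_iff] at hf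
    rcases hf with rfl | rfl | rfl
    · exact ⟨_, h1, rfl⟩
    · exact ⟨_, h2, rfl⟩
    · exact ⟨_, h3, rfl⟩
  obtain ⟨g, hg, rfl⟩ := h hf
  exact hg

/-! ### Operators constant on levels, and equality for odd `D` -/

/-- The operator acting on the `k`-th level of the hypercube as the scalar `g k`. -/
noncomputable def levelOp (D : ℕ) (g : ℕ → ℂ) : Module.End ℂ (X D →₀ ℂ) :=
  opOfBasis fun x => g x.card • Finsupp.single x 1

theorem levelOp_single {D : ℕ} (g : ℕ → ℂ) (x : X D) :
    levelOp D g (Finsupp.single x 1) = g x.card • Finsupp.single x 1 := by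
  rw [levelOp, opOfBasis_single]

theorem aeval_levelOp (D : ℕ) (g : ℕ → ℂ) (p : Polynomial ℂ) :
    Polynomial.aeval (levelOp D g) p = levelOp D fun k => p.eval (g k) := by
  refine end_ext fun x => ?_
  rw [levelOp_single]
  induction p using Polynomial.induction_on' with
  | add p q hp hq => rw [map_add, LinearMap.add_apply, hp, hq, Polynomial.eval_add, add_smul]
  | monomial n a =>
    rw [Polynomial.aeval_monomial, Module.End.mul_apply, Module.algebraMap_end_apply,
      Polynomial.eval_monomial, mul_smul]
    congr 1
    induction n with
    | zero => simp
    | succ n ih =>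
      rw [pow_succ', Module.End.mul_apply, ih, map_smul, levelOp_single, smul_smul, pow_succ]

/-- Lagrange interpolation with the even levels as index set; injectivity of `g` is needed on these
levels only, which is what parity of `D` can provide. -/
theorem exists_polynomial (D : ℕ) (g h : ℕ → ℂ)
    (hg : ∀ k ≤ D, Even k → ∀ l ≤ D, Even l → g k = g l → k = l) :
    ∃ p : Polynomial ℂ, ∀ k ≤ D, Even k → p.eval (g k) = h k := by
  have hinj : Set.InjOn g ((range (D + 1)).filter fun k => Even k : Finset ℕ) := by
    intro k hk l hl hkl
    simp only [coe_filter, mem_range, Set.mem_ofPred_eq, Order.lt_add_one_iff] at hk hl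
    exact hg k hk.1 hk.2 l hl.1 hl.2 hkl
  refine ⟨Lagrange.interpolate _ g h, fun k hk hk' =>
    Lagrange.eval_interpolate_at_node h hinj ?_⟩
  simp [Order.lt_add_one_iff, hk, hk']

theorem CXe_hom_ext {D : ℕ} {f g : invariantSubalgebra (CXe D)}
    (h : ∀ x ∈ Xe D, f.1 (Finsupp.single x 1) = g.1 (Finsupp.single x 1)) :
    restrictHom (CXe D) f = restrictHom (CXe D) g := by
  refine LinearMap.ext fun ⟨v, hv⟩ => Subtype.ext ?_
  change f.1 v = g.1 v
  rw [CXe, Finsupp.supported_eq_span_single] at hv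
  induction hv using Submodule.span_induction with
  | mem w hw => obtain ⟨x, hx, rfl⟩ := hw; exact h x hx
  | zero => simp
  | add a b _ _ ha hb => rw [map_add, map_add, ha, hb]
  | smul c a _ ha => rw [map_smul, map_smul, ha]

theorem levelOp_mem_invariant (D : ℕ) (g : ℕ → ℂ) :
    levelOp D g ∈ invariantSubalgebra (CXe D) := by
  intro v hv
  refine map_supported (fun x hx => ?_) hv
  rw [levelOp_single]
  exact Submodule.smul_mem _ _ (single_mem_supported hx)

/-- Any operator that is constant on the levels is on `ℂ^{X_e}` a polynomial in one that separates
the even levels. -/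
theorem exists_mem_of_levelOp_mem {D : ℕ} {S : Subalgebra ℂ (Module.End ℂ (X D →₀ ℂ))}
    (hS : S ≤ invariantSubalgebra (CXe D)) {g : ℕ → ℂ} (hgS : levelOp D g ∈ S)
    (hg : ∀ k ≤ D, Even k → ∀ l ≤ D, Even l → g k = g l → k = l) (h : ℕ → ℂ) :
    ∃ f, ∃ hf : f ∈ S, restrictHom (CXe D) ⟨levelOp D h, levelOp_mem_invariant D h⟩
      = restrictHom (CXe D) ⟨f, hS hf⟩ := by
  obtain ⟨p, hp⟩ := exists_polynomial D g h hg
  refine ⟨Polynomial.aeval (levelOp D g) p, ?_, CXe_hom_ext fun x hx => ?_⟩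
  · have h1 := Algebra.adjoin_le (S := S) (Set.singleton_subset_iff.2 hgS)
    exact h1 (Polynomial.aeval_mem_adjoin_singleton ℂ _)
  · change levelOp D h _ = Polynomial.aeval (levelOp D g) p _
    rw [aeval_levelOp, levelOp_single, levelOp_single, hp _ (by simpa using card_le_univ x) hx]

theorem opH_eq_levelOp (D : ℕ) : opH D = levelOp D fun k => (D : ℂ) - 2 * (k : ℂ) := rfl

theorem A2star_eq_levelOp (D : ℕ) :
    A2star D = levelOp D fun k => (((D : ℂ) - 2 * (k : ℂ)) ^ 2 - (D : ℂ)) / 2 := rfl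

/-- Equal squares mean `D - 2k = ±(D - 2l)`. The minus sign gives `k + l = D`, and a sum of two even
numbers is not odd. -/
theorem A2star_separates {D : ℕ} (hD : Odd D) (k : ℕ) (_ : k ≤ D) (hk : Even k) (l : ℕ)
    (_ : l ≤ D) (hl : Even l) (hkl : (((D : ℂ) - 2 * (k : ℂ)) ^ 2 - (D : ℂ)) / 2
      = (((D : ℂ) - 2 * (l : ℂ)) ^ 2 - (D : ℂ)) / 2) : k = l := by
  have h1 : ((D : ℂ) - 2 * k) ^ 2 = ((D : ℂ) - 2 * l) ^ 2 := by
    linear_combination 2 * hkl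
  rcases sq_eq_sq_iff_eq_or_eq_neg.1 h1 with h | h
  · have : (k : ℂ) = l := by linear_combination -h / 2
    exact_mod_cast this
  · have : (D : ℂ) = (k + l : ℕ) := by push_cast; linear_combination h / 2
    have h2 : D = k + l := by exact_mod_cast this
    exact absurd (h2 ▸ hk.add hl) (Nat.not_even_iff_odd.2 hD)

theorem Te_le_Re {D : ℕ} (hD : Odd D) : Te D ≤ Re D := by
  intro M hM
  obtain ⟨f, hf, rfl⟩ := mem_Te.1 hM
  refine map_algT_mem (restrictHom (CXe D)) (Re D) ?_ ?_ ?_ hf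
  · exact mem_Re.2 ⟨A2J D, Algebra.subset_adjoin (by simp), rfl⟩
  · exact mem_Re.2 ⟨A2Jbar D, Algebra.subset_adjoin (by simp), rfl⟩
  · have hA : A2star D ∈ algR D := Algebra.subset_adjoin (by simp)
    rw [A2star_eq_levelOp] at hA
    obtain ⟨f, hf, h⟩ := exists_mem_of_levelOp_mem (algR_le_invariant D) hA (A2star_separates hD)
      (fun k => (D : ℂ) - 2 * (k : ℂ))
    exact mem_Re.2 ⟨f, hf, h⟩

/-! ### The complementation symmetry, and strict inclusion for even `D` -/

/-- The operator induced by taking complements. -/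
noncomputable def complOp (D : ℕ) : Module.End ℂ (X D →₀ ℂ) :=
  opOfBasis fun x => Finsupp.single xᶜ 1

theorem complOp_single {D : ℕ} (x : X D) :
    complOp D (Finsupp.single x 1) = Finsupp.single xᶜ 1 := by
  rw [complOp, opOfBasis_single]

theorem R_two_compl {D : ℕ} {x y : X D} : R 2 xᶜ yᶜ ↔ R 2 x y := by
  rw [R_two_iff, R_two_iff]
  refine exists_congr fun a => exists_congr fun b => and_congr_right fun _ => ?_
  have : xᶜ ∆ {a, b} = (x ∆ {a, b})ᶜ := by
    ext c; simp only [mem_compl, mem_symmDiff]; tauto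
  rw [this, compl_inj_iff]

theorem card_compl_eq_iff {D : ℕ} {x y : X D} : xᶜ.card = yᶜ.card ↔ x.card = y.card := by
  have h1 := card_add_card_compl x
  have h2 := card_add_card_compl y
  omega

theorem complOp_comm {D : ℕ} {P : X D → X D → Prop} [∀ x, DecidablePred (P x)]
    (hP : ∀ x y, P xᶜ yᶜ ↔ P x y) :
    Commute (complOp D) (opOfBasis fun x => ∑ y with P x y, Finsupp.single y 1) := by
  refine end_ext fun x => ?_
  simp only [Module.End.mul_apply, opOfBasis_single, map_sum, complOp_single]
  refine sum_nbij' (fun y => yᶜ) (fun y => yᶜ) ?_ ?_ ?_ ?_ ?_ <;> try simp [hP]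
  intro y hy
  rwa [← hP, compl_compl]

theorem complOp_commute_algR {D : ℕ} {f : Module.End ℂ (X D →₀ ℂ)} (hf : f ∈ algR D) :
    Commute (complOp D) f := by
  have h : algR D ≤ Subalgebra.centralizer ℂ {complOp D} := by
    rw [algR, Algebra.adjoin_le_iff]
    intro f hf
    simp only [Set.mem_insert_iff, Set.mem_singleton_iff] at hf
    simp only [SetLike.mem_coe, Subalgebra.mem_centralizer_iff, Set.mem_singleton_iff, forall_eq]
    rcases hf with rfl | rfl | rfl
    · exact complOp_comm fun x y => by rw [R_two_compl, card_compl_eq_iff]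
    · exact complOp_comm fun x y => by rw [R_two_compl, Ne, card_compl_eq_iff]
    · refine end_ext fun x => ?_
      simp only [Module.End.mul_apply, A2star, opOfBasis_single, map_smul, complOp_single]
      congr 1
      -- Complementation negates `D - 2|x|`, and `A₂^*` sees only its square.
      have : (x.card : ℂ) + (xᶜ.card : ℂ) = D := by
        exact_mod_cast (card_add_card_compl x).trans (Fintype.card_fin D)
      rw [← this]
      ring
  exact (Subalgebra.mem_centralizer_iff ℂ).1 (h hf) _ rfl

theorem Re_ne_Te {D : ℕ} (h0 : D ≠ 0) (hD : Even D) : Re D ≠ Te D := by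
  intro h
  have hH : restrictHom (CXe D) ⟨opH D, algT_le_invariant D (opH_mem_algT D)⟩ ∈ Re D := by
    rw [h]
    exact mem_Te.2 ⟨_, opH_mem_algT D, rfl⟩
  obtain ⟨f, hf, hfH⟩ := mem_Re.1 hH
  have key : ∀ x ∈ Xe D, opH D (Finsupp.single x 1) = f (Finsupp.single x 1) := fun x hx =>
    congrArg Subtype.val (LinearMap.congr_fun hfH ⟨_, single_mem_supported hx⟩)
  -- Both `∅` and its complement are even vertices, so `f` acts on them as `H`, with eigenvalues `D`
  -- and `-D`. Commuting with complementation forces `D = -D`.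
  have hc := LinearMap.congr_fun (complOp_commute_algR hf).eq (Finsupp.single ∅ 1)
  rw [Module.End.mul_apply, Module.End.mul_apply, complOp_single, ← key _ (by simp [Xe]),
    ← key _ (by simpa [Xe] using hD), opH_single, opH_single, map_smul, complOp_single] at hc
  have hc' := DFunLike.congr_fun hc ∅ᶜ
  simp only [Finsupp.smul_apply, Finsupp.single_eq_same, smul_eq_mul, mul_one, card_empty,
    compl_empty, card_univ, Fintype.card_fin, Nat.cast_zero] at hc'
  have : (D : ℂ) = 0 := by linear_combination hc' / 2
  exact h0 (by exact_mod_cast this)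

/-! ### Distance from the empty set in the halved cube -/

theorem card_le_of_R_two {D : ℕ} {x y : X D} (h : R 2 x y) : y.card ≤ x.card + 2 := by
  obtain ⟨a, b, hab, rfl⟩ := R_two_iff.1 h
  have h1 : x ∆ {a, b} ⊆ x ∪ {a, b} := symmDiff_le_sup
  exact (card_le_card h1).trans ((card_union_le _ _).trans (by rw [card_pair hab]))

theorem card_le_of_walk {D : ℕ} {x y : Xe D} (w : (halvedGraph D).Walk x y) :
    y.1.card ≤ x.1.card + 2 * w.length := by
  induction w with
  | nil => simp
  | cons h w ih =>
    have := card_le_of_R_two h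
    rw [SimpleGraph.Walk.length_cons]
    omega

theorem exists_walk_of_card {D : ℕ} (n : ℕ) (x : Xe D) (hx : x.1.card = 2 * n) :
    ∃ w : (halvedGraph D).Walk (emptyVertex D) x, w.length = n := by
  induction n generalizing x with
  | zero =>
    obtain rfl : x = emptyVertex D := Subtype.ext (card_eq_zero.1 hx)
    exact ⟨.nil, rfl⟩
  | succ n ih =>
    obtain ⟨t, ht, htc⟩ := exists_subset_card_eq (s := x.1) (n := 2) (by omega)
    have hc : (x.1 \ t).card = 2 * n := by rw [card_sdiff_of_subset ht]; omega
    have hR : R 2 (x.1 \ t) x.1 := by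
      obtain ⟨a, b, hab, rfl⟩ := card_eq_two.1 htc
      refine R_two_iff.2 ⟨a, b, hab, ?_⟩
      ext c
      have := @ht c
      simp only [mem_symmDiff, mem_sdiff]
      tauto
    obtain ⟨w, hw⟩ := ih ⟨x.1 \ t, by simp [Xe, hc]⟩ hc
    exact ⟨w.concat hR, (w.length_concat hR).trans (congrArg (· + 1) hw)⟩

/-- An edge raises the cardinality by at most two, which bounds the distance from below; building
`x` up two elements at a time attains the bound. -/
theorem halvedGraph_dist {D : ℕ} (x : Xe D) :
    2 * (halvedGraph D).dist (emptyVertex D) x = x.1.card := by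
  obtain ⟨n, hn⟩ := even_iff_exists_two_mul.1 (show Even x.1.card from x.2)
  obtain ⟨w, hw⟩ := exists_walk_of_card n x hn
  have h1 := SimpleGraph.dist_le w
  obtain ⟨w', hw'⟩ := w.reachable.exists_walk_length_eq_dist
  have h2 := card_le_of_walk w'
  have h3 : (emptyVertex D).1.card = 0 := rfl
  omega

/-! ### Identification with the Terwilliger algebra -/

/-- Restriction to `ℂ^{X_e}`, followed by the identification with the space with basis `X_e`. -/
noncomputable def restrictEquivHom (D : ℕ) :
    invariantSubalgebra (CXe D) →ₐ[ℂ] Module.End ℂ (Xe D →₀ ℂ) :=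
  (endEquiv D).toAlgHom.comp (restrictHom (CXe D))

theorem restrictEquivHom_single_apply {D : ℕ} (f : invariantSubalgebra (CXe D)) (x y : Xe D) :
    restrictEquivHom D f (Finsupp.single x 1) y = f.1 (Finsupp.single x.1 1) y.1 := by
  change f.1 ((Finsupp.supportedEquivFinsupp (M := ℂ) (R := ℂ) (Xe D)).symm
    (Finsupp.single x 1) : X D →₀ ℂ) y.1 = _
  rw [Finsupp.supportedEquivFinsupp_symm_single]

theorem end_ext_apply {α : Type*} {f g : Module.End ℂ (α →₀ ℂ)}
    (h : ∀ x y, f (Finsupp.single x 1) y = g (Finsupp.single x 1) y) : f = g :=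
  Finsupp.lhom_ext' fun x => LinearMap.ext_ring (Finsupp.ext fun y => h x y)

theorem sum_single_filter_apply {α : Type*} [Fintype α] [DecidableEq α] (P : α → Prop)
    [DecidablePred P] (y : α) :
    (∑ z with P z, Finsupp.single z (1 : ℂ)) y = if P y then 1 else 0 := by
  simp [Finsupp.finsetSum_apply, Finsupp.single_apply]

theorem restrictEquivHom_adjacency (D : ℕ) :
    restrictEquivHom D ⟨A2J D + A2Jbar D, algT_le_invariant D
      (add_mem (A2J_mem_algT D) (A2Jbar_mem_algT D))⟩ = adjacencyOp (halvedGraph D) := by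
  classical
  refine end_ext_apply fun x y => ?_
  rw [restrictEquivHom_single_apply]
  change A2J D _ y.1 + A2Jbar D _ y.1 = _
  rw [A2J, A2Jbar, adjacencyOp, opOfBasis_single, opOfBasis_single, opOfBasis_single,
    sum_single_filter_apply, sum_single_filter_apply, sum_single_filter_apply]
  have h : (halvedGraph D).Adj x y ↔ R 2 x.1 y.1 := Iff.rfl
  by_cases h1 : y.1.card = x.1.card <;> simp [h1, h]

theorem restrictEquivHom_levelOp_single_apply {D : ℕ} (g : ℕ → ℂ) (x y : Xe D) :
    restrictEquivHom D ⟨levelOp D g, levelOp_mem_invariant D g⟩ (Finsupp.single x 1) y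
      = g x.1.card * Finsupp.single x 1 y := by
  classical
  rw [restrictEquivHom_single_apply, levelOp_single, Finsupp.smul_apply, smul_eq_mul]
  simp only [Finsupp.single_apply, Subtype.ext_iff]

theorem restrictEquivHom_levelOp_eq_dualIdempotent (D i : ℕ) :
    restrictEquivHom D ⟨levelOp D fun k => if k = 2 * i then 1 else 0, levelOp_mem_invariant D _⟩
      = dualIdempotent (halvedGraph D) (emptyVertex D) i := by
  refine end_ext_apply fun x y => ?_
  rw [restrictEquivHom_levelOp_single_apply, dualIdempotent, opOfBasis_single,
    ← halvedGraph_dist x]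
  simp only [mul_right_inj' two_ne_zero]
  split_ifs <;> simp

/-- Level `2i` is the sphere of radius `i` around `∅`, so this is a spectral decomposition. The
range is longer than necessary; at each vertex only the index equal to its distance contributes. -/
theorem restrictEquivHom_levelOp (D : ℕ) (g : ℕ → ℂ) :
    restrictEquivHom D ⟨levelOp D g, levelOp_mem_invariant D g⟩
      = ∑ i ∈ range (D + 1), g (2 * i) • dualIdempotent (halvedGraph D) (emptyVertex D) i := by
  refine end_ext_apply fun x y => ?_
  have hx : (halvedGraph D).dist (emptyVertex D) x ∈ range (D + 1) := by
    have h1 := halvedGraph_dist x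
    have h2 : x.1.card ≤ D := by simpa using card_le_univ x.1
    rw [mem_range]
    omega
  rw [restrictEquivHom_levelOp_single_apply, LinearMap.sum_apply, Finsupp.finsetSum_apply,
    sum_eq_single_of_mem _ hx]
  · rw [halvedGraph_dist, LinearMap.smul_apply, dualIdempotent, opOfBasis_single, if_pos rfl,
      Finsupp.smul_apply, smul_eq_mul]
  · intro i _ hi
    rw [LinearMap.smul_apply, dualIdempotent, opOfBasis_single, if_neg hi.symm]
    simp

theorem mem_map_Te {D : ℕ} {M : Module.End ℂ (Xe D →₀ ℂ)} :
    M ∈ (Te D).map (endEquiv D).toAlgHom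
      ↔ ∃ f, ∃ hf : f ∈ algT D, M = restrictEquivHom D ⟨f, algT_le_invariant D hf⟩ := by
  constructor
  · rintro ⟨N, hN, rfl⟩
    obtain ⟨f, hf, rfl⟩ := mem_Te.1 hN
    exact ⟨f, hf, rfl⟩
  · rintro ⟨f, hf, rfl⟩
    exact ⟨_, mem_Te.2 ⟨f, hf, rfl⟩, rfl⟩

/-- `H` commutes with the level-preserving part `A₂^J`, so the double bracket with `H` sees only
`A₂^J̄`. It is expanded with a coefficient `-2` in place of subtractions, to match
`map_mem_of_double_commutator`, which is stated over semirings. -/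
theorem double_commutator_adjacency (D : ℕ) :
    opH D * (opH D * (A2J D + A2Jbar D)) + (-2 : ℂ) • (opH D * (A2J D + A2Jbar D) * opH D)
      + (A2J D + A2Jbar D) * opH D * opH D = (16 : ℂ) • A2Jbar D := by
  rw [← commutator_commutator]
  have h1 := commutator_opH_A2J D
  have e1 : opH D * (opH D * A2Jbar D - A2Jbar D * opH D)
      = opH D * opH D * A2Jbar D - opH D * A2Jbar D * opH D := LinearMap.comp_sub _ _ _
  have e2 : (opH D * A2Jbar D - A2Jbar D * opH D) * opH D
      = opH D * A2Jbar D * opH D - A2Jbar D * opH D * opH D := LinearMap.sub_comp _ _ _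
  rw [e1, e2]
  simp only [mul_add, add_mul, h1, ← mul_assoc]
  module

theorem map_mem_of_double_commutator {A B : Type*} [Semiring A] [Semiring B] [Algebra ℂ A]
    [Algebra ℂ B] {φ : A →ₐ[ℂ] B} {T : Subalgebra ℂ B} {a b h : A}
    (hcomm : h * (h * a) + (-2 : ℂ) • (h * a * h) + a * h * h = (16 : ℂ) • b)
    (hh : φ h ∈ T) (ha : φ a ∈ T) : φ b ∈ T := by
  have hb : b = (16⁻¹ : ℂ) • (h * (h * a) + (-2 : ℂ) • (h * a * h) + a * h * h) := by
    rw [hcomm, smul_smul, inv_mul_cancel₀ (by norm_num), one_smul]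
  rw [hb]
  simp only [map_smul, map_mul, map_add]
  exact T.smul_mem (add_mem (add_mem (mul_mem hh (mul_mem hh ha))
    (T.smul_mem (mul_mem (mul_mem hh ha) hh) _)) (mul_mem (mul_mem ha hh) hh)) _

theorem map_Te_eq_terwilligerAlgebra (D : ℕ) :
    (Te D).map (endEquiv D).toAlgHom
      = terwilligerAlgebra (halvedGraph D) (emptyVertex D) := by
  apply le_antisymm
  · intro M hM
    obtain ⟨f, hf, rfl⟩ := mem_map_Te.1 hM
    set T := terwilligerAlgebra (halvedGraph D) (emptyVertex D)
    have hA : adjacencyOp (halvedGraph D) ∈ T := Algebra.subset_adjoin (by simp)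
    have hE : ∀ i, dualIdempotent (halvedGraph D) (emptyVertex D) i ∈ T := fun i =>
      Algebra.subset_adjoin (by simp)
    set jJ : invariantSubalgebra (CXe D) := ⟨A2J D, algT_le_invariant D (A2J_mem_algT D)⟩
    set jB : invariantSubalgebra (CXe D) :=
      ⟨A2Jbar D, algT_le_invariant D (A2Jbar_mem_algT D)⟩
    set h : invariantSubalgebra (CXe D) := ⟨opH D, algT_le_invariant D (opH_mem_algT D)⟩
    have hH : restrictEquivHom D h ∈ T := by
      have := restrictEquivHom_levelOp D fun k => (D : ℂ) - 2 * (k : ℂ)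
      change restrictEquivHom D h = _ at this
      rw [this]
      exact sum_mem fun i _ => T.smul_mem (hE i) _
    have hJB : restrictEquivHom D (jJ + jB) ∈ T := by
      have := restrictEquivHom_adjacency D
      change restrictEquivHom D (jJ + jB) = _ at this
      rwa [this]
    have hcomm : h * (h * (jJ + jB)) + (-2 : ℂ) • (h * (jJ + jB) * h) + (jJ + jB) * h * h
        = (16 : ℂ) • jB := Subtype.ext (double_commutator_adjacency D)
    have hsub : jJ = jJ + jB + (-1 : ℂ) • jB := by
      refine Subtype.ext ?_
      change A2J D = A2J D + A2Jbar D + (-1 : ℂ) • A2Jbar D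
      module
    have hB := map_mem_of_double_commutator hcomm hH hJB
    have hJ : restrictEquivHom D jJ ∈ T := by
      rw [hsub, map_add, map_smul]
      exact add_mem hJB (T.smul_mem hB _)
    exact map_algT_mem (restrictEquivHom D) T hJ hB hH hf
  · rw [terwilligerAlgebra, Algebra.adjoin_le_iff]
    rintro M (hM | ⟨i, rfl⟩)
    · rw [Set.mem_singleton_iff.1 hM]
      exact mem_map_Te.2 ⟨_, add_mem (A2J_mem_algT D) (A2Jbar_mem_algT D),
        (restrictEquivHom_adjacency D).symm⟩
    · rw [← restrictEquivHom_levelOp_eq_dualIdempotent]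
      have hH := opH_mem_algT D
      rw [opH_eq_levelOp] at hH
      -- Unlike the eigenvalue of `A₂^*`, `D - 2k` is injective in `k`, so no condition on the
      -- parity of `D` enters.
      obtain ⟨f, hf, h⟩ := exists_mem_of_levelOp_mem (algT_le_invariant D) hH
        (fun k _ _ l _ _ hkl => by
          have : (k : ℂ) = l := by linear_combination -hkl / 2
          exact_mod_cast this) (fun k => if k = 2 * i then 1 else 0)
      exact mem_map_Te.2 ⟨f, hf, congrArg (endEquiv D).toAlgHom h⟩

end Hypercube

theorem mainTheorem10 (D : ℕ) (hD : 2 ≤ D) :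
    (Hypercube.Te D).map (Hypercube.endEquiv D).toAlgHom
        = terwilligerAlgebra (Hypercube.halvedGraph D) (Hypercube.emptyVertex D)
    ∧ Hypercube.Re D ≤ Hypercube.Te D
    ∧ (Hypercube.Re D = Hypercube.Te D ↔ Odd D) := by
  refine ⟨Hypercube.map_Te_eq_terwilligerAlgebra D, Hypercube.Re_le_Te D, fun h => ?_, fun h =>
    le_antisymm (Hypercube.Re_le_Te D) (Hypercube.Te_le_Re h)⟩
  by_contra hodd
  exact Hypercube.Re_ne_Te (by omega) (Nat.not_odd_iff_even.1 hodd) h
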